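/- Let $M$ and $N$ be complex manifolds (finite-dimensional, Hausdorff, second countable), each equipped with a smooth Hermitian metric, and let $N$ be compact. Let $\mathcal C(M,N)$ be the space of continuous maps $M\to N$ with the compact-open topology. A family $\mathscr F\subset\mathcal C(M,N)$ is called normal if each sequence in $\mathscr F$ has a subsequence $(f_j)$ which is either relatively compact in $\mathcal C(M,N)$ or compactly divergent, the latter meaning that for all compact sets $K\subset M$ and $L\subset N$ one has $f_j(K)\cap L=\emptyset$ for all sufficiently large $j$. For a holomorphic map $f:M\to N$ and $x\in M$ let $$\|df_x\|=\sup_{0\ne\xi\in T^{1,0}_xM}\frac{\|df_x(\xi)\|_N}{\|\xi\|_M}$$ be the operator norm of its differential (equal to $0$ if $\dim_x M=0$). Let $\mathscr F$ be a family of holomorphic maps $M\to N$. Then $\mathscr F$ is normal if and only if $\{\|df\|\}_{f\in\mathscr F}$ is locally uniformly bounded on $M$, that is, every point $x_0\in M$ has a neighbourhood $U$ for which there is a constant $C<\infty$ with $\|df_x\|\le C$ for all $f\in\mathscr F$ and all $x\in U$. -/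

import Mathlib

open scoped Manifold ContDiff NNReal ENNReal

noncomputable section

/-- A Hermitian metric on a complex manifold `M` modelled on `E`: a positive definite Hermitian form
on each holomorphic tangent space, depending smoothly (real `C^∞`) on the base point. The complex
vector space `TangentSpace 𝓘(ℂ, E) x` is the holomorphic tangent space `T^{1,0}_x M`. As usual in
Mathlib, the forms are conjugate-linear in the first variable. -/
structure HermitianMetric (E : Type*) [NormedAddCommGroup E] [NormedSpace ℂ E]
    (M : Type*) [TopologicalSpace M] [ChartedSpace E M] where
  /-- The Hermitian form on the tangent space at `x`. -/
  form (x : M) :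
    TangentSpace 𝓘(ℂ, E) x →ₗ⋆[ℂ] TangentSpace 𝓘(ℂ, E) x →ₗ[ℂ] ℂ
  symm (x : M) (v w : TangentSpace 𝓘(ℂ, E) x) :
    starRingEnd ℂ (form x v w) = form x w v
  pos (x : M) (v : TangentSpace 𝓘(ℂ, E) x) (hv : v ≠ 0) : 0 < (form x v v).re
  /-- In every preferred chart, the coefficients of the metric with respect to constant
  coordinate vector fields are smooth functions of the coordinate. -/
  smooth (x₀ : M) (v w : E) :
    ContDiffOn ℝ ∞
      (fun z : E ↦ form ((extChartAt 𝓘(ℂ, E) x₀).symm z)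
        (mfderiv 𝓘(ℂ, E) 𝓘(ℂ, E) (extChartAt 𝓘(ℂ, E) x₀).symm z v)
        (mfderiv 𝓘(ℂ, E) 𝓘(ℂ, E) (extChartAt 𝓘(ℂ, E) x₀).symm z w))
      (extChartAt 𝓘(ℂ, E) x₀).target

/-- The length of a tangent vector with respect to a Hermitian metric. -/
def HermitianMetric.norm {E : Type*} [NormedAddCommGroup E] [NormedSpace ℂ E]
    {M : Type*} [TopologicalSpace M] [ChartedSpace E M] (g : HermitianMetric E M) (x : M)
    (v : TangentSpace 𝓘(ℂ, E) x) : ℝ :=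
  Real.sqrt (g.form x v v).re

/-- The operator norm `‖df_x‖ = sup_{ξ ≠ 0} ‖df_x ξ‖_N / ‖ξ‖_M`, as an element of `[0, ∞]`. -/
def diffOpNorm {E : Type*} [NormedAddCommGroup E] [NormedSpace ℂ E]
    {F : Type*} [NormedAddCommGroup F] [NormedSpace ℂ F]
    {M : Type*} [TopologicalSpace M] [ChartedSpace E M]
    {N : Type*} [TopologicalSpace N] [ChartedSpace F N]
    (g : HermitianMetric E M) (h : HermitianMetric F N) (f : M → N) (x : M) : ℝ≥0∞ :=
  ⨆ (ξ : TangentSpace 𝓘(ℂ, E) x) (_ : ξ ≠ 0),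
    ENNReal.ofReal (h.norm (f x) (mfderiv 𝓘(ℂ, E) 𝓘(ℂ, F) f x ξ) / g.norm x ξ)

/-- A sequence of continuous maps is compactly divergent if for all compact `K ⊆ M` and `L ⊆ N`,
the image of `K` under `u j` misses `L` for all large `j`. -/
def CompactlyDivergent {M : Type*} [TopologicalSpace M] {N : Type*} [TopologicalSpace N]
    (u : ℕ → C(M, N)) : Prop :=
  ∀ (K : Set M) (L : Set N), IsCompact K → IsCompact L →
    ∃ j₀ : ℕ, ∀ j ≥ j₀, (u j '' K) ∩ L = ∅

/-- A family of continuous maps is normal if each sequence in it has a subsequence which is either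
relatively compact in `C(M, N)` (with the compact-open topology) or compactly divergent. -/
def IsNormalFamily {M : Type*} [TopologicalSpace M] {N : Type*} [TopologicalSpace N]
    (𝓕 : Set C(M, N)) : Prop :=
  ∀ u : ℕ → C(M, N), (∀ j, u j ∈ 𝓕) → ∃ φ : ℕ → ℕ, StrictMono φ ∧
    (IsCompact (closure (Set.range (u ∘ φ))) ∨ CompactlyDivergent (u ∘ φ))

end

open Set Filter Topology Metric


/-! Over compact pieces of charts a Hermitian metric is comparable to the norm of the model space,
so differential bounds can be passed to coordinates and back.

Normal implies bounded: a holomorphic map carrying a fixed coordinate ball into a fixed coordinate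
ball has its derivative controlled by the Cauchy estimate. This mapping condition is open in the
compact-open topology, so every continuous map `f`, holomorphic or not, has a neighbourhood whose
holomorphic members share a bound near `x₀` (`exists_nhds_diffOpNorm_le`). A relatively compact
sequence is covered by finitely many such neighbourhoods, so its differentials cannot blow up at
points tending to `x₀`. Compact divergence is impossible because `N` is compact.

Bounded implies normal: integrating the bound along a coordinate segment shows that maps sending
`x₀` near `y₀` send a common neighbourhood of `x₀` near `y₀`
(`exists_nhds_mapsTo_of_diffOpNorm_le`). Compactness of `N` turns this even continuity into
equicontinuity, and Arzelà–Ascoli applies. No distance function on `M` or `N` is needed. -/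

/-- A continuous family of positive definite sesquilinear forms is uniformly comparable to the norm
over a compact set of parameters. -/
lemma exists_bounds_sqrt_sesquilinear {E : Type*} [NormedAddCommGroup E] [NormedSpace ℂ E]
    [FiniteDimensional ℂ E] {Z : Type*} [TopologicalSpace Z] {K : Set Z} (hK : IsCompact K)
    (B : Z → E →ₗ⋆[ℂ] E →ₗ[ℂ] ℂ) (hB : ∀ v w, ContinuousOn (fun z ↦ B z v w) K)
    (hpos : ∀ z ∈ K, ∀ v ≠ 0, 0 < (B z v v).re) :
    ∃ c > 0, ∃ C > 0, ∀ z ∈ K, ∀ v,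
      c * ‖v‖ ≤ Real.sqrt (B z v v).re ∧ Real.sqrt (B z v v).re ≤ C * ‖v‖ := by
  have := FiniteDimensional.proper ℂ E
  let b := Module.finBasis ℂ E
  -- Continuity in `z` is given only for fixed vectors; expanding in a basis makes the form jointly
  -- continuous in `z` and `v`.
  have hexp (z : Z) (v : E) : B z v v =
      ∑ i, ∑ j, starRingEnd ℂ (b.equivFunL v i) * (b.equivFunL v j * B z (b i) (b j)) := by
    conv_lhs => rw [← b.sum_repr v]
    simp only [map_sum, LinearMap.sum_apply, map_smulₛₗ, LinearMap.smul_apply, smul_eq_mul,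
      RingHom.id_apply, Finset.mul_sum]
    refine Finset.sum_comm.trans (Finset.sum_congr rfl fun i _ ↦ Finset.sum_congr rfl fun j _ ↦ ?_)
    simp only [Module.Basis.equivFunL_apply]
    ring
  have hcont : ContinuousOn (fun p : Z × E ↦ (B p.1 p.2 p.2).re) (K ×ˢ sphere 0 1) := by
    refine Complex.continuous_re.comp_continuousOn ?_
    simp only [hexp]
    refine continuousOn_finsetSum _ fun i _ ↦ continuousOn_finsetSum _ fun j _ ↦ ?_
    have hc (i) : Continuous fun p : Z × E ↦ b.equivFunL p.2 i :=
      (continuous_apply i).comp (b.equivFunL.continuous.comp continuous_snd)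
    exact (Complex.continuous_conj.comp (hc i)).continuousOn.mul ((hc j).continuousOn.mul
      ((hB (b i) (b j)).comp continuousOn_fst fun p hp ↦ hp.1))
  have hcpt : IsCompact (K ×ˢ sphere (0 : E) 1) := hK.prod (isCompact_sphere _ _)
  obtain ⟨m, hm, hle⟩ := hcpt.exists_forall_le' hcont (a := 0) fun p hp ↦
    hpos p.1 hp.1 p.2 (ne_zero_of_mem_unit_sphere (⟨p.2, hp.2⟩ : sphere (0 : E) 1))
  obtain ⟨C, hC⟩ := hcpt.exists_bound_of_continuousOn hcont
  -- `C` need not be positive, for instance when the sphere is empty; `|C| + 1` is.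
  refine ⟨√m, Real.sqrt_pos.2 hm, √(|C| + 1), by positivity, fun z hz v ↦ ?_⟩
  rcases eq_or_ne v 0 with rfl | hv
  · simp
  have hv' : 0 < ‖v‖ := norm_pos_iff.2 hv
  set u : E := ((‖v‖⁻¹ : ℝ) : ℂ) • v with hu
  have hu1 : u ∈ sphere (0 : E) 1 := by
    simp [hu, norm_smul, hv'.ne']
  have hvu : v = ((‖v‖ : ℝ) : ℂ) • u := by
    rw [hu, smul_smul, ← Complex.ofReal_mul, mul_inv_cancel₀ hv'.ne', Complex.ofReal_one, one_smul]
  have hom (a : ℝ) (w : E) : (B z ((a : ℂ) • w) ((a : ℂ) • w)).re = (B z w w).re * a ^ 2 := by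
    rw [map_smul, map_smulₛₗ, LinearMap.smul_apply, Complex.conj_ofReal, smul_eq_mul, smul_eq_mul,
      Complex.re_ofReal_mul, Complex.re_ofReal_mul]
    ring
  have hBv : (B z v v).re = (B z u u).re * ‖v‖ ^ 2 := by rw [← hom, ← hvu]
  have h1 := hle (z, u) ⟨hz, hu1⟩
  have h2 := (le_abs_self _).trans (hC (z, u) ⟨hz, hu1⟩)
  rw [hBv, Real.sqrt_mul' _ (sq_nonneg _), Real.sqrt_sq hv'.le]
  refine ⟨?_, ?_⟩
  · gcongr
  · gcongr
    exact h2.trans ((le_abs_self C).trans (by linarith))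

/-! ### Hermitian metrics and holomorphic maps in charts -/

section Charts

variable {E : Type*} [NormedAddCommGroup E] [NormedSpace ℂ E]
  {M : Type*} [TopologicalSpace M] [ChartedSpace E M]
  {F : Type*} [NormedAddCommGroup F] [NormedSpace ℂ F]
  {N : Type*} [TopologicalSpace N] [ChartedSpace F N]

lemma mdifferentiableAt_extChartAt_symm [IsManifold 𝓘(ℂ, E) ω M] (x₀ : M) {z : E}
    (hz : z ∈ (extChartAt 𝓘(ℂ, E) x₀).target) :
    MDifferentiableAt 𝓘(ℂ, E) 𝓘(ℂ, E) (extChartAt 𝓘(ℂ, E) x₀).symm z := by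
  have : IsManifold 𝓘(ℂ, E) 1 M := IsManifold.of_le (n := ω) le_top
  simpa [mdifferentiableWithinAt_univ] using mdifferentiableWithinAt_extChartAt_symm hz

/-- The derivative at `x` of the chart around `x₀`, with values in the model space. -/
noncomputable def chartDeriv (x₀ x : M) : TangentSpace 𝓘(ℂ, E) x →L[ℂ] E :=
  mfderiv 𝓘(ℂ, E) 𝓘(ℂ, E) (extChartAt 𝓘(ℂ, E) x₀) x

/-- The derivative at `z` of the inverse of the chart around `x₀`, defined on the model space. -/
noncomputable def chartSymmDeriv (x₀ : M) (z : E) :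
    E →L[ℂ] TangentSpace 𝓘(ℂ, E) ((extChartAt 𝓘(ℂ, E) x₀).symm z) :=
  mfderiv 𝓘(ℂ, E) 𝓘(ℂ, E) (extChartAt 𝓘(ℂ, E) x₀).symm z

lemma chartSymmDeriv_chartDeriv [IsManifold 𝓘(ℂ, E) ω M] (x₀ : M) {z : E}
    (hz : z ∈ (extChartAt 𝓘(ℂ, E) x₀).target)
    (ξ : TangentSpace 𝓘(ℂ, E) ((extChartAt 𝓘(ℂ, E) x₀).symm z)) :
    chartSymmDeriv x₀ z (chartDeriv x₀ ((extChartAt 𝓘(ℂ, E) x₀).symm z) ξ) = ξ := by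
  have : IsManifold 𝓘(ℂ, E) 1 M := IsManifold.of_le (n := ω) le_top
  have := mfderivWithin_extChartAt_symm_comp_mfderiv_extChartAt (I := 𝓘(ℂ, E)) hz
  simp only [modelWithCornersSelf_coe, range_id, mfderivWithin_univ] at this
  exact congr($this ξ)

lemma chartDeriv_chartSymmDeriv [IsManifold 𝓘(ℂ, E) ω M] (x₀ : M) {z : E}
    (hz : z ∈ (extChartAt 𝓘(ℂ, E) x₀).target) (v : E) :
    chartDeriv x₀ ((extChartAt 𝓘(ℂ, E) x₀).symm z) (chartSymmDeriv x₀ z v) = v := by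
  have : IsManifold 𝓘(ℂ, E) 1 M := IsManifold.of_le (n := ω) le_top
  have := mfderiv_extChartAt_comp_mfderivWithin_extChartAt_symm (I := 𝓘(ℂ, E)) hz
  simp only [modelWithCornersSelf_coe, range_id, mfderivWithin_univ] at this
  exact congr($this v)

/-- Over a compact subset of a chart, a Hermitian metric is comparable to the norm of the model
space. -/
lemma HermitianMetric.exists_norm_bounds [FiniteDimensional ℂ E] [IsManifold 𝓘(ℂ, E) ω M]
    (g : HermitianMetric E M) (x₀ : M) {K : Set E} (hK : IsCompact K)
    (hKt : K ⊆ (extChartAt 𝓘(ℂ, E) x₀).target) :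
    ∃ c > 0, ∃ C > 0, ∀ x ∈ (extChartAt 𝓘(ℂ, E) x₀).source, extChartAt 𝓘(ℂ, E) x₀ x ∈ K →
      ∀ ξ : TangentSpace 𝓘(ℂ, E) x,
        c * ‖chartDeriv x₀ x ξ‖ ≤ g.norm x ξ ∧ g.norm x ξ ≤ C * ‖chartDeriv x₀ x ξ‖ := by
  -- Pulling the forms back by the inverse chart puts them all on the single space `E`, where the
  -- compactness argument applies.
  let B (z : E) : E →ₗ⋆[ℂ] E →ₗ[ℂ] ℂ := LinearMap.mk₂'ₛₗ (starRingEnd ℂ) (RingHom.id ℂ)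
    (fun v w ↦ g.form ((extChartAt 𝓘(ℂ, E) x₀).symm z)
      (chartSymmDeriv x₀ z v) (chartSymmDeriv x₀ z w))
    (fun _ _ _ ↦ by rw [map_add, map_add, LinearMap.add_apply])
    (fun _ _ _ ↦ by rw [map_smul, map_smulₛₗ, LinearMap.smul_apply])
    (fun _ _ _ ↦ by rw [map_add, map_add])
    (fun _ _ _ ↦ by rw [map_smul, map_smul]; rfl)
  obtain ⟨c, hc, C, hC, H⟩ := exists_bounds_sqrt_sesquilinear hK B
    (fun v w ↦ ((g.smooth x₀ v w).continuousOn).mono hKt) fun z hz v hv ↦ by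
      refine g.pos _ _ fun h0 ↦ hv ?_
      rw [← chartDeriv_chartSymmDeriv x₀ (hKt hz) v, h0, map_zero]
  refine ⟨c, hc, C, hC, fun x hx hxK ξ ↦ ?_⟩
  obtain ⟨z, hz, rfl⟩ : ∃ z ∈ (extChartAt 𝓘(ℂ, E) x₀).target, (extChartAt 𝓘(ℂ, E) x₀).symm z = x :=
    ⟨_, (extChartAt 𝓘(ℂ, E) x₀).map_source hx, (extChartAt 𝓘(ℂ, E) x₀).left_inv hx⟩
  rw [(extChartAt 𝓘(ℂ, E) x₀).right_inv hz] at hxK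
  have h1 := H z hxK (chartDeriv x₀ _ ξ)
  have h2 : B z (chartDeriv x₀ _ ξ) (chartDeriv x₀ _ ξ) = g.form _ ξ ξ := by
    simp only [B, LinearMap.mk₂'ₛₗ_apply, chartSymmDeriv_chartDeriv x₀ hz]
  rwa [h2] at h1

lemma HermitianMetric.norm_zero (g : HermitianMetric E M) (x : M) : g.norm x 0 = 0 := by
  simp [HermitianMetric.norm]

lemma HermitianMetric.norm_pos (g : HermitianMetric E M) {x : M} {ξ : TangentSpace 𝓘(ℂ, E) x}
    (hξ : ξ ≠ 0) : 0 < g.norm x ξ :=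
  Real.sqrt_pos.2 (g.pos x ξ hξ)

/-- At `ξ = 0` both sides vanish, so the restriction `ξ ≠ 0` in the supremum can be dropped. This
also covers dimension zero, where the supremum is empty. -/
lemma diffOpNorm_le_iff (g : HermitianMetric E M) (h : HermitianMetric F N) (f : M → N) (x : M)
    (C : ℝ≥0) : diffOpNorm g h f x ≤ C ↔ ∀ ξ : TangentSpace 𝓘(ℂ, E) x,
      h.norm (f x) (mfderiv 𝓘(ℂ, E) 𝓘(ℂ, F) f x ξ) ≤ C * g.norm x ξ := by
  simp only [diffOpNorm, iSup_le_iff]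
  refine forall_congr' fun ξ ↦ ?_
  rcases eq_or_ne ξ 0 with rfl | hξ
  · simp [HermitianMetric.norm_zero]
  · rw [← div_le_iff₀ (g.norm_pos hξ), forall_prop_of_true hξ, ← ENNReal.ofReal_coe_nnreal,
      ENNReal.ofReal_le_ofReal_iff C.coe_nonneg]

/-- The expression of a holomorphic map in charts, and its derivative. -/
lemma differentiableAt_chart_expr [IsManifold 𝓘(ℂ, E) ω M] [IsManifold 𝓘(ℂ, F) ω N] {f : M → N}
    (hf : MDifferentiable 𝓘(ℂ, E) 𝓘(ℂ, F) f) (x₀ : M) (y₀ : N) {z : E}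
    (hz : z ∈ (extChartAt 𝓘(ℂ, E) x₀).target)
    (hfz : f ((extChartAt 𝓘(ℂ, E) x₀).symm z) ∈ (extChartAt 𝓘(ℂ, F) y₀).source) :
    DifferentiableAt ℂ (extChartAt 𝓘(ℂ, F) y₀ ∘ f ∘ (extChartAt 𝓘(ℂ, E) x₀).symm) z ∧
    ∀ v : E, fderiv ℂ (extChartAt 𝓘(ℂ, F) y₀ ∘ f ∘ (extChartAt 𝓘(ℂ, E) x₀).symm) z v =
      chartDeriv y₀ (f ((extChartAt 𝓘(ℂ, E) x₀).symm z))
        (mfderiv 𝓘(ℂ, E) 𝓘(ℂ, F) f ((extChartAt 𝓘(ℂ, E) x₀).symm z) (chartSymmDeriv x₀ z v)) := by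
  have : IsManifold 𝓘(ℂ, F) 1 N := IsManifold.of_le (n := ω) le_top
  have h1 := (mdifferentiableAt_extChartAt_symm x₀ hz).hasMFDerivAt
  have h2 := (hf ((extChartAt 𝓘(ℂ, E) x₀).symm z)).hasMFDerivAt
  have h3 := (mdifferentiableAt_extChartAt (I := 𝓘(ℂ, F)) (x := y₀)
    (by simpa using hfz)).hasMFDerivAt
  have h4 : HasFDerivAt (extChartAt 𝓘(ℂ, F) y₀ ∘ f ∘ (extChartAt 𝓘(ℂ, E) x₀).symm)
      ((chartDeriv y₀ (f ((extChartAt 𝓘(ℂ, E) x₀).symm z))).comp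
        ((mfderiv 𝓘(ℂ, E) 𝓘(ℂ, F) f ((extChartAt 𝓘(ℂ, E) x₀).symm z)).comp
          (chartSymmDeriv x₀ z))) z := (h3.comp z (h2.comp z h1)).hasFDerivAt
  refine ⟨h4.differentiableAt, fun v ↦ ?_⟩
  rw [h4.fderiv]
  rfl

lemma exists_closedBall_subset_chart (x₀ : M) {O : Set M} (hO : O ∈ 𝓝 x₀) :
    ∃ r > 0, closedBall (extChartAt 𝓘(ℂ, E) x₀ x₀) r ⊆ (extChartAt 𝓘(ℂ, E) x₀).target ∧
      ∀ z ∈ closedBall (extChartAt 𝓘(ℂ, E) x₀ x₀) r, (extChartAt 𝓘(ℂ, E) x₀).symm z ∈ O := by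
  have h1 := extChartAt_target_mem_nhds (I := 𝓘(ℂ, E)) x₀
  have h2 : (extChartAt 𝓘(ℂ, E) x₀).symm ⁻¹' O ∈ 𝓝 (extChartAt 𝓘(ℂ, E) x₀ x₀) := by
    refine (continuousAt_extChartAt_symm x₀).preimage_mem_nhds ?_
    rwa [extChartAt_to_inv]
  obtain ⟨r, hr, h⟩ := nhds_basis_closedBall.mem_iff.1 (inter_mem h1 h2)
  exact ⟨r, hr, fun z hz ↦ (h hz).1, fun z hz ↦ (h hz).2⟩

/-- The preimage of a ball under a chart. -/
def chartBall (E : Type*) [NormedAddCommGroup E] [NormedSpace ℂ E] {M : Type*} [TopologicalSpace M]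
    [ChartedSpace E M] (x₀ : M) (r : ℝ) : Set M :=
  (extChartAt 𝓘(ℂ, E) x₀).source ∩
    extChartAt 𝓘(ℂ, E) x₀ ⁻¹' ball (extChartAt 𝓘(ℂ, E) x₀ x₀) r

lemma isOpen_chartBall (x₀ : M) (r : ℝ) : IsOpen (chartBall E x₀ r) :=
  (continuousOn_extChartAt x₀).isOpen_inter_preimage (isOpen_extChartAt_source x₀) isOpen_ball

lemma chartBall_mem_nhds (x₀ : M) {r : ℝ} (hr : 0 < r) : chartBall E x₀ r ∈ 𝓝 x₀ :=
  (isOpen_chartBall x₀ r).mem_nhds ⟨mem_extChartAt_source x₀, mem_ball_self hr⟩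

end Charts

/-! ### Compact targets, and paths confined to a chart -/

/-- Maps to a compact space are never compactly divergent, unless the source is empty. -/
lemma not_compactlyDivergent {M N : Type*} [TopologicalSpace M] [TopologicalSpace N] [Nonempty M]
    [CompactSpace N] (u : ℕ → C(M, N)) :
    ¬ CompactlyDivergent u := by
  intro hu
  obtain ⟨x⟩ := ‹Nonempty M›
  obtain ⟨j, hj⟩ := hu {x} univ isCompact_singleton isCompact_univ
  simpa using hj j le_rfl

/-- A path whose velocity, read in a chart, is at most `k` as long as the path stays in the ball of
radius `r > k`, stays in this ball up to time `1`. -/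
lemma norm_chart_path_le {F : Type*} [NormedAddCommGroup F] [NormedSpace ℂ F]
    [FiniteDimensional ℂ F] {N : Type*} [TopologicalSpace N] [T2Space N] [ChartedSpace F N]
    (y₀ : N) {γ : ℝ → N} (hγ : ContinuousOn γ (Icc 0 1))
    {p : F} {r k : ℝ} (hk : 0 ≤ k) (hkr : k < r)
    (hr : closedBall p r ⊆ (extChartAt 𝓘(ℂ, F) y₀).target)
    (h0 : γ 0 ∈ (extChartAt 𝓘(ℂ, F) y₀).source) (hp : extChartAt 𝓘(ℂ, F) y₀ (γ 0) = p)
    {v : ℝ → F} (hd : ∀ t ∈ Icc (0 : ℝ) 1, γ t ∈ (extChartAt 𝓘(ℂ, F) y₀).source →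
      extChartAt 𝓘(ℂ, F) y₀ (γ t) ∈ ball p r →
      HasDerivWithinAt (extChartAt 𝓘(ℂ, F) y₀ ∘ γ) (v t) (Icc 0 1) t ∧ ‖v t‖ ≤ k) :
    ∀ t ∈ Icc (0 : ℝ) 1, γ t ∈ (extChartAt 𝓘(ℂ, F) y₀).source ∧
      ‖extChartAt 𝓘(ℂ, F) y₀ (γ t) - p‖ ≤ k * t := by
  have := FiniteDimensional.proper ℂ F
  set ψ := extChartAt 𝓘(ℂ, F) y₀ with hψ
  have hrk {t : ℝ} (ht : t ∈ Icc (0 : ℝ) 1) : k * t ≤ k := mul_le_of_le_one_right hk ht.2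
  set S : Set ℝ := {t | γ t ∈ ψ.source ∧ ‖ψ (γ t) - p‖ ≤ k * t} with hS
  -- The chart domain is not closed in general, but this compact subset is, since `N` is Hausdorff;
  -- hence a path cannot leave the chart in the limit.
  have hQ : IsClosed (ψ.symm '' closedBall p r) :=
    ((isCompact_closedBall _ _).image_of_continuousOn
      ((continuousOn_extChartAt_symm y₀).mono hr)).isClosed
  have hC := hγ.preimage_isClosed_of_isClosed isClosed_Icc hQ
  have hCs : Icc (0 : ℝ) 1 ∩ γ ⁻¹' (ψ.symm '' closedBall p r) ⊆ γ ⁻¹' ψ.source := by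
    rintro t ⟨-, z, hz, hzt⟩
    rw [mem_preimage, ← hzt]
    exact ψ.map_target (hr hz)
  have hcont : ContinuousOn (fun t ↦ ψ (γ t))
      (Icc (0 : ℝ) 1 ∩ γ ⁻¹' (ψ.symm '' closedBall p r)) :=
    (continuousOn_extChartAt y₀).comp (hγ.mono inter_subset_left) hCs
  have hclosed : IsClosed (S ∩ Icc 0 1) := by
    have h1 := hC.isClosed_le (hcont.sub (continuousOn_const (c := p))).norm
      (g := fun t ↦ k * t) (by fun_prop)
    convert! h1 using 1
    ext t
    constructor
    · rintro ⟨⟨h1, h2⟩, ht⟩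
      exact ⟨⟨ht, ψ (γ t), mem_closedBall_iff_norm.2 (h2.trans ((hrk ht).trans hkr.le)),
        ψ.left_inv h1⟩, h2⟩
    · rintro ⟨h1, h2⟩
      exact ⟨⟨hCs h1, h2⟩, h1.1⟩
  -- Continuous induction: `S` is closed, contains `0`, and has points just to the right of each of
  -- its points before time `1`. The strict inequality `k < r` leaves room to continue.
  refine hclosed.Icc_subset_of_forall_exists_gt (a := 0) (b := 1) ⟨h0, by simp [hp]⟩ ?_
  rintro t ⟨⟨hts, htn⟩, ht⟩ y hy
  have hO : IsOpen (ψ.source ∩ ψ ⁻¹' ball p r) :=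
    (continuousOn_extChartAt y₀).isOpen_inter_preimage (isOpen_extChartAt_source y₀) isOpen_ball
  have htI : t ∈ Icc (0 : ℝ) 1 := Ico_subset_Icc_self ht
  have htb : ψ (γ t) ∈ ball p r := mem_ball_iff_norm.2 (htn.trans_lt ((hrk htI).trans_lt hkr))
  obtain ⟨ε, hε, hsub⟩ := Metric.mem_nhdsWithin_iff.1
    ((hγ t htI).preimage_mem_nhdsWithin (hO.mem_nhds ⟨hts, htb⟩))
  set s := min (min y 1) (t + ε / 2) with hs
  have hts' : t < s := lt_min (lt_min hy ht.2) (by linarith)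
  have hs1 : s ≤ 1 := (min_le_left _ _).trans (min_le_right _ _)
  have hsε : s ≤ t + ε / 2 := min_le_right _ _
  have hsub' : Icc t s ⊆ Icc 0 1 := Icc_subset_Icc ht.1 hs1
  have hin : ∀ τ ∈ Icc t s, γ τ ∈ ψ.source ∩ ψ ⁻¹' ball p r := fun τ hτ ↦ by
    refine hsub ⟨?_, hsub' hτ⟩
    rw [mem_ball, Real.dist_eq, abs_of_nonneg (by linarith [hτ.1])]
    linarith [hτ.2]
  refine ⟨s, ⟨(hin s (right_mem_Icc.2 hts'.le)).1, ?_⟩, hts',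
    (min_le_left _ _).trans (min_le_left _ _)⟩
  have hmv := (convex_Icc t s).norm_image_sub_le_of_norm_hasDerivWithin_le
    (fun τ hτ ↦ (hd τ (hsub' hτ) (hin τ hτ).1 (hin τ hτ).2).1.mono hsub')
    (fun τ hτ ↦ (hd τ (hsub' hτ) (hin τ hτ).1 (hin τ hτ).2).2)
    (left_mem_Icc.2 hts'.le) (right_mem_Icc.2 hts'.le)
  rw [Real.norm_of_nonneg (by linarith)] at hmv
  calc ‖ψ (γ s) - p‖ ≤ ‖ψ (γ s) - ψ (γ t)‖ + ‖ψ (γ t) - p‖ :=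
        norm_sub_le_norm_sub_add_norm_sub _ _ _
    _ ≤ k * (s - t) + k * t := add_le_add hmv htn
    _ = k * s := by ring

/-! ### Cauchy estimates and even continuity -/

section Normality

variable {E : Type*} [NormedAddCommGroup E] [NormedSpace ℂ E] [FiniteDimensional ℂ E]
  {M : Type*} [TopologicalSpace M] [ChartedSpace E M] [IsManifold 𝓘(ℂ, E) ω M]
  {F : Type*} [NormedAddCommGroup F] [NormedSpace ℂ F] [FiniteDimensional ℂ F]
  {N : Type*} [TopologicalSpace N] [ChartedSpace F N] [IsManifold 𝓘(ℂ, F) ω N]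

/-- **Cauchy estimate**: near a continuous map, in the compact-open topology, the differentials of
holomorphic maps are locally uniformly bounded. -/
lemma exists_nhds_diffOpNorm_le (g : HermitianMetric E M) (h : HermitianMetric F N)
    (f : C(M, N)) (x₀ : M) :
    ∃ W ∈ 𝓝 f, ∃ U ∈ 𝓝 x₀, ∃ C : ℝ≥0, ∀ f' ∈ W, MDifferentiable 𝓘(ℂ, E) 𝓘(ℂ, F) f' →
      ∀ x ∈ U, diffOpNorm g h f' x ≤ C := by
  have := FiniteDimensional.proper ℂ E
  have := FiniteDimensional.proper ℂ F
  obtain ⟨r, hr, hrt, -⟩ := exists_closedBall_subset_chart (E := F) (f x₀) univ_mem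
  obtain ⟨R, hR, hRt, hRO⟩ := exists_closedBall_subset_chart (E := E) x₀
    (f.continuous.continuousAt.preimage_mem_nhds (chartBall_mem_nhds (E := F) (f x₀) hr))
  obtain ⟨cg, hcg, _, _, Hg⟩ := g.exists_norm_bounds x₀ (isCompact_closedBall _ _) hRt
  obtain ⟨_, _, Ch, hCh, Hh⟩ := h.exists_norm_bounds (f x₀) (isCompact_closedBall _ _) hrt
  set φ := extChartAt 𝓘(ℂ, E) x₀ with hφ
  set ψ := extChartAt 𝓘(ℂ, F) (f x₀) with hψ
  have hKc : IsCompact (φ.symm '' closedBall (φ x₀) R) :=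
    (isCompact_closedBall _ _).image_of_continuousOn ((continuousOn_extChartAt_symm x₀).mono hRt)
  -- In the constant, `2 * r / (R / 2)` is the Cauchy bound on a ball of radius `R / 2` about a
  -- point of the smaller ball, where the coordinate values differ from the central one by less than
  -- `2 * r`. The factors `Ch` and `1 / cg` convert model norms into the metrics.
  refine ⟨{f' | MapsTo f' (φ.symm '' closedBall (φ x₀) R) (chartBall F (f x₀) r)},
    (ContinuousMap.isOpen_setOfPred_mapsTo hKc (isOpen_chartBall _ _)).mem_nhds ?_,
    chartBall E x₀ (R / 2), chartBall_mem_nhds x₀ (half_pos hR),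
    (Ch * (2 * r / (R / 2)) / cg).toNNReal, fun f' hf' hd x hx ↦ ?_⟩
  · rintro _ ⟨z, hz, rfl⟩
    exact hRO z hz
  rw [diffOpNorm_le_iff, Real.coe_toNNReal _ (by positivity)]
  intro ξ
  obtain ⟨z, hz, rfl⟩ : ∃ z ∈ φ.target, φ.symm z = x :=
    ⟨_, φ.map_source hx.1, φ.left_inv hx.1⟩
  have hzb : z ∈ ball (φ x₀) (R / 2) := by
    have h1 : φ (φ.symm z) ∈ ball (φ x₀) (R / 2) := hx.2
    rwa [φ.right_inv hz] at h1
  have hsub : ball z (R / 2) ⊆ closedBall (φ x₀) R :=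
    (ball_subset_ball' (by linarith [mem_ball.1 hzb])).trans ball_subset_closedBall
  have hmaps : ∀ w ∈ ball z (R / 2), f' (φ.symm w) ∈ chartBall F (f x₀) r := fun w hw ↦
    hf' ⟨w, hsub hw, rfl⟩
  have hz' := hmaps z (mem_ball_self (half_pos hR))
  have hfd : ‖fderiv ℂ (ψ ∘ f' ∘ φ.symm) z‖ ≤ 2 * r / (R / 2) := by
    refine Complex.norm_fderiv_le_div_of_mapsTo_ball (fun w hw ↦
      ((differentiableAt_chart_expr hd x₀ (f x₀) (hRt (hsub hw))
        (hmaps w hw).1).1.differentiableWithinAt)) (fun w hw ↦ ?_) (half_pos hR)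
    have h1 := mem_ball.1 (hmaps w hw).2
    have h2 := mem_ball.1 hz'.2
    rw [mem_closedBall]
    refine (dist_triangle_right _ _ (ψ (f x₀))).trans ?_
    simp only [Function.comp_apply]
    linarith
  have h1 := (Hh _ hz'.1 (ball_subset_closedBall hz'.2)
    (mfderiv 𝓘(ℂ, E) 𝓘(ℂ, F) f' (φ.symm z) ξ)).2
  have h2 := (Hg _ hx.1 (by rw [φ.right_inv hz]; exact hsub (mem_ball_self (half_pos hR))) ξ).1
  have h3 := (differentiableAt_chart_expr hd x₀ (f x₀) hz hz'.1).2 (chartDeriv x₀ _ ξ)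
  rw [chartSymmDeriv_chartDeriv x₀ hz] at h3
  rw [← h3] at h1
  calc _ ≤ _ := h1
    _ ≤ Ch * (2 * r / (R / 2) * ‖chartDeriv x₀ (φ.symm z) ξ‖) := by
        gcongr
        exact ContinuousLinearMap.le_of_opNorm_le _ hfd _
    _ ≤ Ch * (2 * r / (R / 2) * (g.norm (φ.symm z) ξ / cg)) := by
        gcongr
        rw [le_div_iff₀ hcg, mul_comm]
        exact h2
    _ = Ch * (2 * r / (R / 2)) / cg * g.norm (φ.symm z) ξ := by ring

/-- The differentials of a normal family of holomorphic maps are locally uniformly bounded. -/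
lemma IsNormalFamily.exists_diffOpNorm_le [FirstCountableTopology M] [CompactSpace N]
    (g : HermitianMetric E M) (h : HermitianMetric F N) {𝓕 : Set C(M, N)}
    (h𝓕 : ∀ f ∈ 𝓕, MDifferentiable 𝓘(ℂ, E) 𝓘(ℂ, F) f) (hn : IsNormalFamily 𝓕) (x₀ : M) :
    ∃ U ∈ 𝓝 x₀, ∃ C : ℝ≥0, ∀ f ∈ 𝓕, ∀ x ∈ U, diffOpNorm g h f x ≤ C := by
  by_contra! hcon
  have : Nonempty M := ⟨x₀⟩
  obtain ⟨V, hV⟩ := (𝓝 x₀).exists_antitone_basis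
  -- If no bound exists, there are maps `u j` and points `x j` tending to `x₀` at which the
  -- differential norm of `u j` exceeds `j`.
  choose u hu x hx hgt using fun j : ℕ ↦ hcon (V j) (hV.mem j) j
  obtain ⟨φ, hφ, hφ' | hφ'⟩ := hn u hu
  · choose W hW U hU C hC using fun f : C(M, N) ↦ exists_nhds_diffOpNorm_le g h f x₀
    obtain ⟨t, -, ht⟩ := hφ'.elim_nhds_subcover W fun f _ ↦ hW f
    have hUt : (⋂ f ∈ t, U f) ∈ 𝓝 x₀ := (biInter_finset_mem t).2 fun f _ ↦ hU f
    -- Each `u (φ j)` lies in one of finitely many `W f`, so the largest of their constants bounds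
    -- the whole subsequence near `x₀`.
    have hbd (j : ℕ) (hj : x (φ j) ∈ ⋂ f ∈ t, U f) : (φ j : ℝ≥0) < t.sup C := by
      obtain ⟨f, hft, hf⟩ := mem_iUnion₂.1 (ht (subset_closure ⟨j, rfl⟩))
      have := (hgt (φ j)).trans_le
        (hC f _ hf (h𝓕 _ (hu _)) _ (mem_iInter₂.1 hj f hft))
      exact (ENNReal.coe_lt_coe.1 this).trans_le (Finset.le_sup hft)
    have hxt : Tendsto (x ∘ φ) atTop (𝓝 x₀) := (hV.tendsto hx).comp hφ.tendsto_atTop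
    obtain ⟨n, hn⟩ := exists_nat_ge (t.sup C)
    obtain ⟨j, hj1, hj2⟩ := ((hxt.eventually hUt).and (eventually_ge_atTop n)).exists
    have h1 : (n : ℝ≥0) ≤ φ j := by exact_mod_cast hj2.trans (hφ.id_le j)
    exact (hbd j hj1).not_ge (hn.trans h1)
  · exact not_compactlyDivergent _ hφ'

/-- If the differentials of a family of holomorphic maps are bounded near `x₀`, then the family is
evenly continuous at `x₀`. -/
lemma exists_nhds_mapsTo_of_diffOpNorm_le [T2Space N] (g : HermitianMetric E M)
    (h : HermitianMetric F N) {𝓕 : Set C(M, N)}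
    (h𝓕 : ∀ f ∈ 𝓕, MDifferentiable 𝓘(ℂ, E) 𝓘(ℂ, F) f) {x₀ : M} {U : Set M} (hU : U ∈ 𝓝 x₀)
    {C : ℝ≥0} (hC : ∀ f ∈ 𝓕, ∀ x ∈ U, diffOpNorm g h f x ≤ C) (y₀ : N) {V : Set N}
    (hV : V ∈ 𝓝 y₀) :
    ∃ V' ∈ 𝓝 y₀, ∃ U' ∈ 𝓝 x₀, ∀ f ∈ 𝓕, f x₀ ∈ V' → MapsTo f U' V := by
  have := FiniteDimensional.proper ℂ E
  have := FiniteDimensional.proper ℂ F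
  obtain ⟨r, hr, hrt, hrV⟩ := exists_closedBall_subset_chart (E := F) y₀ hV
  obtain ⟨R, hR, hRt, hRU⟩ := exists_closedBall_subset_chart (E := E) x₀ hU
  obtain ⟨_, _, Cg, hCg, Hg⟩ := g.exists_norm_bounds x₀ (isCompact_closedBall _ _) hRt
  obtain ⟨ch, hch, _, _, Hh⟩ := h.exists_norm_bounds y₀ (isCompact_closedBall _ _) hrt
  set φ := extChartAt 𝓘(ℂ, E) x₀ with hφ
  set ψ := extChartAt 𝓘(ℂ, F) y₀ with hψ
  -- `L` bounds the derivative of the maps in coordinates.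
  set L : ℝ := C * Cg / ch with hL
  have hL0 : 0 ≤ L := by positivity
  obtain ⟨δ, hδ, hδR, hδL⟩ : ∃ δ > 0, δ ≤ R ∧ L * δ < r / 2 := by
    -- Dividing by `L + 1` allows `L = 0` and makes the inequality strict.
    refine ⟨min R (r / 2 / (L + 1)), by positivity, min_le_left _ _, ?_⟩
    calc L * min R (r / 2 / (L + 1)) ≤ L * (r / 2 / (L + 1)) := by
          gcongr; exact min_le_right _ _
      _ < (L + 1) * (r / 2 / (L + 1)) := by
          gcongr; linarith
      _ = r / 2 := by field_simp
  refine ⟨chartBall F y₀ (r / 2), chartBall_mem_nhds y₀ (half_pos hr), chartBall E x₀ δ,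
    chartBall_mem_nhds x₀ hδ, fun f hf hfx x hx ↦ ?_⟩
  have hfx2 : ψ (f x₀) ∈ ball (ψ y₀) (r / 2) := hfx.2
  have hx2 : φ x ∈ ball (φ x₀) δ := hx.2
  set w := φ x - φ x₀ with hw
  have hwδ : ‖w‖ < δ := mem_ball_iff_norm.1 hx2
  have hline : ∀ t ∈ Icc (0 : ℝ) 1, φ x₀ + t • w ∈ closedBall (φ x₀) R := fun t ht ↦ by
    rw [mem_closedBall_iff_norm, add_sub_cancel_left, norm_smul, Real.norm_of_nonneg ht.1]
    nlinarith [ht.1, ht.2, norm_nonneg w]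
  have hbsub : closedBall (ψ (f x₀)) (r / 2) ⊆ closedBall (ψ y₀) r :=
    closedBall_subset_closedBall' (by linarith [mem_ball.1 hfx2])
  have hγ : ContinuousOn (fun t : ℝ ↦ f (φ.symm (φ x₀ + t • w))) (Icc 0 1) :=
    f.continuous.comp_continuousOn ((continuousOn_extChartAt_symm x₀).comp
      (by fun_prop) fun t ht ↦ hRt (hline t ht))
  have hx0 : φ.symm (φ x₀) = x₀ := extChartAt_to_inv x₀
  -- The image of the segment from `φ x₀` to `φ x` starts within `r / 2` of the centre and has speed
  -- at most `L * δ < r / 2` while it stays within `r / 2` of its start, so it never leaves the ball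
  -- of radius `r`.
  have key := norm_chart_path_le y₀ hγ (p := ψ (f x₀)) (k := L * δ) (by positivity) hδL
    (hbsub.trans hrt)
    (by simpa [hx0] using hfx.1) (by simp only [zero_smul, add_zero, hx0, hψ])
    (v := fun t ↦ fderiv ℂ (ψ ∘ f ∘ φ.symm) (φ x₀ + t • w) w) fun t ht hts htb ↦ by
      have hz := hRt (hline t ht)
      obtain ⟨hd1, hd2⟩ := differentiableAt_chart_expr (h𝓕 f hf) x₀ y₀ hz hts
      constructor
      · have hlin : HasDerivAt (fun t : ℝ ↦ φ x₀ + t • w) w t := by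
          simpa using ((hasDerivAt_id t).smul_const w).const_add (φ x₀)
        exact ((hd1.hasFDerivAt.restrictScalars ℝ).comp_hasDerivAt t hlin).hasDerivWithinAt
      · have h1 := (Hh _ hts (hbsub (ball_subset_closedBall htb))
          (mfderiv 𝓘(ℂ, E) 𝓘(ℂ, F) f (φ.symm (φ x₀ + t • w)) (chartSymmDeriv x₀ _ w))).1
        have h2 := (diffOpNorm_le_iff g h f _ C).1 (hC f hf _ (hRU _ (hline t ht)))
          (chartSymmDeriv x₀ _ w)
        have h3 := (Hg _ (φ.map_target hz) (by rw [φ.right_inv hz]; exact hline t ht)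
          (chartSymmDeriv x₀ _ w)).2
        rw [chartDeriv_chartSymmDeriv x₀ hz] at h3
        rw [← hd2] at h1
        calc ‖fderiv ℂ (ψ ∘ f ∘ φ.symm) (φ x₀ + t • w) w‖
            ≤ C * (Cg * ‖w‖) / ch := by
              rw [le_div_iff₀ hch, mul_comm]
              exact h1.trans (h2.trans (by gcongr))
          _ = L * ‖w‖ := by rw [hL]; ring
          _ ≤ L * δ := by gcongr
  obtain ⟨h1, h2⟩ := key 1 (by simp)
  have hfin : φ.symm (φ x₀ + (1 : ℝ) • w) = x := by
    rw [one_smul, hw, add_sub_cancel, φ.left_inv hx.1]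
  simp only [hfin] at h1 h2
  have h3 := hrV (ψ (f x)) (hbsub (mem_closedBall_iff_norm.2 (by linarith)))
  rwa [ψ.left_inv h1] at h3

end Normality

/-! ### Equicontinuity, Arzelà–Ascoli and the main theorem -/

/-- An evenly continuous family of maps to a compact space is equicontinuous. -/
lemma equicontinuousAt_of_forall_exists_nhds {X Y : Type*} [TopologicalSpace X] [UniformSpace Y]
    [CompactSpace Y] {S : Set C(X, Y)} {x₀ : X}
    (hS : ∀ (y : Y), ∀ V ∈ 𝓝 y, ∃ V' ∈ 𝓝 y, ∃ U ∈ 𝓝 x₀, ∀ f ∈ S, f x₀ ∈ V' → MapsTo f U V) :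
    EquicontinuousAt (fun f : S ↦ ((f : C(X, Y)) : X → Y)) x₀ := by
  intro W hW
  obtain ⟨W', hW', hsymm, hcomp⟩ := comp_symm_mem_uniformity_sets hW
  -- The values `f x` and `f x₀` are both `W'`-close to a common `y`, hence `W`-close to each other.
  -- Finitely many `y` suffice, so one neighbourhood of `x₀` serves all `f`.
  choose V hV U hU H using fun y ↦ hS y _ (UniformSpace.ball_mem_nhds y hW')
  obtain ⟨t, ht⟩ := CompactSpace.elim_nhds_subcover V hV
  filter_upwards [(biInter_finset_mem t).2 fun y _ ↦ hU y] with x hx f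
  obtain ⟨y, hyt, hy⟩ := mem_iUnion₂.1 (ht.ge (mem_univ (f.1 x₀)))
  have h1 := H y f f.2 hy (mem_iInter₂.1 hx y hyt)
  have h2 := H y f f.2 hy (mem_of_mem_nhds (hU y))
  exact hcomp ⟨y, hsymm.symm _ _ h2, h1⟩

/-- **Arzelà–Ascoli**: an equicontinuous family of maps from a locally compact space to a compact
Hausdorff space is relatively compact. -/
lemma isCompact_closure_of_equicontinuous {X Y : Type*} [TopologicalSpace X]
    [WeaklyLocallyCompactSpace X] [UniformSpace Y] [CompactSpace Y] [T2Space Y] {S : Set C(X, Y)}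
    (hS : Equicontinuous (fun f : S ↦ ((f : C(X, Y)) : X → Y))) : IsCompact (closure S) := by
  refine ArzelaAscoli.isCompact_closure_of_isClosedEmbedding (𝔖 := {K | IsCompact K})
    (F := fun f : C(X, Y) ↦ (f : X → Y)) (fun K hK ↦ hK) ?_ (fun K _ ↦ hS.equicontinuousOn K)
    fun _ _ _ _ ↦ ⟨univ, isCompact_univ, fun _ _ ↦ mem_univ _⟩
  refine ⟨ContinuousMap.isUniformEmbedding_toUniformOnFunIsCompact.isEmbedding, ?_⟩
  -- The range is closed because a limit of continuous maps, uniform on compact sets, is continuous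
  -- when every point has a compact neighbourhood.
  have := ContinuousMap.range_toUniformOnFunIsCompact (α := X) (β := Y)
  refine this ▸ UniformOnFun.isClosed_setOfPred_continuous ?_
  exact .of_nhds fun x ↦ exists_compact_mem_nhds x

theorem mainTheorem8
    {E : Type*} [NormedAddCommGroup E] [NormedSpace ℂ E] [FiniteDimensional ℂ E]
    {F : Type*} [NormedAddCommGroup F] [NormedSpace ℂ F] [FiniteDimensional ℂ F]
    {M : Type*} [TopologicalSpace M] [T2Space M] [SecondCountableTopology M]
    [ChartedSpace E M] [IsManifold 𝓘(ℂ, E) ω M]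
    {N : Type*} [TopologicalSpace N] [T2Space N] [CompactSpace N]
    [ChartedSpace F N] [IsManifold 𝓘(ℂ, F) ω N]
    (g : HermitianMetric E M) (h : HermitianMetric F N)
    (𝓕 : Set C(M, N)) (h𝓕 : ∀ f ∈ 𝓕, MDifferentiable 𝓘(ℂ, E) 𝓘(ℂ, F) f) :
    IsNormalFamily 𝓕 ↔
      ∀ x₀ : M, ∃ U ∈ nhds x₀, ∃ C : ℝ≥0, ∀ f ∈ 𝓕, ∀ x ∈ U,
        diffOpNorm g h f x ≤ (C : ℝ≥0∞) := by
  -- In the converse the full sequence is already relatively compact, so the subsequence is the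
  -- identity one.
  refine ⟨fun hn x₀ ↦ hn.exists_diffOpNorm_le g h h𝓕 x₀, fun hb u hu ↦
    ⟨id, strictMono_id, Or.inl ?_⟩⟩
  have := FiniteDimensional.proper ℂ E
  have : LocallyCompactSpace M := ChartedSpace.locallyCompactSpace E M
  -- The uniformity comes from the compact Hausdorff topology alone, not from the metric `h`.
  let _ : UniformSpace N := uniformSpaceOfCompactR1
  refine isCompact_closure_of_equicontinuous fun x₀ ↦
    equicontinuousAt_of_forall_exists_nhds fun y V hV ↦ ?_
  obtain ⟨U, hU, C, hC⟩ := hb x₀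
  obtain ⟨V', hV', U', hU', H⟩ := exists_nhds_mapsTo_of_diffOpNorm_le g h h𝓕 hU hC y hV
  refine ⟨V', hV', U', hU', ?_⟩
  rintro _ ⟨j, rfl⟩
  exact H _ (hu j)
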